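/- For an entire function $f:\mathbb{C}\to\mathbb{C}$, let its order $\alpha(f)\in[0,\infty]$ be the infimum of all real $\alpha\ge 0$ such that $\log\max_{|z|\le r}|f(z)|\le O(r^\alpha)$ as $r\to\infty$ (and $+\infty$ if there is no such $\alpha$). For a real number $\rho\ge 0$ let $\mathscr{H}^\rho$ be the ring of entire functions $f$ with $\alpha(f)\le\rho$. Consider the Pell equation $$X^2-(z^2-1)Y^2=1. \qquad (*)$$ The pairs of entire functions solving $(*)$ form an abelian group under $(u,v)\oplus(x,y)=(ux+(z^2-1)vy,\ uy+vx)$; write $(x,y)^{\oplus k}$ for the $k$-th multiple of $(x,y)$ in this group. For $n\in\mathbb{Z}$ define polynomials $x_n,y_n\in\mathbb{C}[z]$ by $x_n+y_nw=(z+w)^n$, where $w=\sqrt{z^2-1}$. Let $\rho\ge 0$ be a real number, let $m=2(\lfloor\rho\rfloor+1)$, let $p,q$ be primes with $p>m+1$ and $q>2(m+1)$, and let $k=pq$. Let $(x,y)$ be a solution of $(*)$ with $x,y\in\mathscr{H}^\rho$ such that (i) there is a solution $(s,t)$ of $(*)$ with $s,t\in\mathscr{H}^\rho$ and $(s,t)^{\oplus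 k}=(x,y)$; and (ii) the polynomial $y_k$ divides $y$ in $\mathscr{H}^\rho$. Then $y=y_{kn}$ for some integer $n$. Conversely, for every integer $\ell$, the pair $(x,y)=(x_{k\ell},y_{k\ell})$ is a solution of $(*)$ with $x,y\in\mathscr{H}^\rho$, and it satisfies (i) and (ii). -/

import Mathlib

open Polynomial Filter
open scoped ENNReal NNReal

noncomputable section

/-- The ring of entire functions of one complex variable, with pointwise operations. -/
def Entire : Subring (ℂ → ℂ) where
  carrier := {f | Differentiable ℂ f}
  mul_mem' hf hg := Differentiable.mul hf hg
  one_mem' := differentiable_const 1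
  add_mem' hf hg := Differentiable.add hf hg
  zero_mem' := differentiable_const 0
  neg_mem' hf := Differentiable.neg hf

/-- A complex polynomial regarded as an entire function. -/
def polyEntire (P : ℂ[X]) : Entire := ⟨fun z => P.eval z, P.differentiable⟩

/-- The coordinate function `z`. -/
def coordZ : Entire := polyEntire X

/-- `max_{|z| ≤ r} |f(z)|`. -/
def maxModulus (f : Entire) (r : ℝ) : ℝ :=
  sSup ((fun z : ℂ => ‖f.1 z‖) '' Metric.closedBall 0 r)

/-- The order of an entire function: the infimum of the real `α ≥ 0` with
`log max_{|z| ≤ r} |f(z)| ≤ O(r ^ α)` as `r → ∞`; it is `∞` if there is no such `α`. -/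
def growthOrder (f : Entire) : ℝ≥0∞ :=
  ⨅ (α : ℝ≥0) (_ : ∃ C : ℝ, ∀ᶠ r : ℝ in atTop,
    Real.log (maxModulus f r) ≤ C * r ^ (α : ℝ)), (α : ℝ≥0∞)

/-- The entire functions of order at most `ρ` (used for `ρ ≥ 0`). -/
def boundedOrder (ρ : ℝ) : Set Entire := {f | growthOrder f ≤ ENNReal.ofReal ρ}

/-- `f` divides `g` in the ring of entire functions of order at most `ρ`. -/
def DvdBoundedOrder (ρ : ℝ) (f g : Entire) : Prop :=
  f ∈ boundedOrder ρ ∧ g ∈ boundedOrder ρ ∧ ∃ h ∈ boundedOrder ρ, g = f * h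

/-- The element `z + w` of `ℂ[z][w]`, `w ^ 2 = z ^ 2 - 1`, as a unit with inverse `z - w`. -/
def zAddW : (QuadraticAlgebra ℂ[X] (X ^ 2 - 1) 0)ˣ where
  val := ⟨X, 1⟩
  inv := ⟨X, -1⟩
  val_inv := by
    ext1 <;> simp [QuadraticAlgebra.re_one, QuadraticAlgebra.im_one]; ring
  inv_val := by
    ext1 <;> simp [QuadraticAlgebra.re_one, QuadraticAlgebra.im_one]; ring

/-- The polynomial `x_n` in `x_n + y_n w = (z + w) ^ n`. -/
def pellX (n : ℤ) : ℂ[X] := ((zAddW ^ n : (QuadraticAlgebra ℂ[X] (X ^ 2 - 1) 0)ˣ) :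
  QuadraticAlgebra ℂ[X] (X ^ 2 - 1) 0).re

/-- The polynomial `y_n` in `x_n + y_n w = (z + w) ^ n`. -/
def pellY (n : ℤ) : ℂ[X] := ((zAddW ^ n : (QuadraticAlgebra ℂ[X] (X ^ 2 - 1) 0)ˣ) :
  QuadraticAlgebra ℂ[X] (X ^ 2 - 1) 0).im

/-- A solution `(x, y)` in entire functions of `x ^ 2 - (z ^ 2 - 1) * y ^ 2 = 1`. -/
@[ext]
structure PellSolution where
  x : Entire
  y : Entire
  pell : x ^ 2 - (coordZ ^ 2 - 1) * y ^ 2 = 1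

namespace PellSolution

instance : Add PellSolution where
  add a b :=
    { x := a.x * b.x + (coordZ ^ 2 - 1) * a.y * b.y
      y := a.x * b.y + a.y * b.x
      pell := by
        linear_combination (b.x ^ 2 - (coordZ ^ 2 - 1) * b.y ^ 2) * a.pell + b.pell }

instance : Zero PellSolution := ⟨⟨1, 0, by ring⟩⟩

instance : Neg PellSolution :=
  ⟨fun a => ⟨a.x, -a.y, by linear_combination a.pell⟩⟩

theorem add_x (a b : PellSolution) :
    (a + b).x = a.x * b.x + (coordZ ^ 2 - 1) * a.y * b.y := rfl

theorem add_y (a b : PellSolution) : (a + b).y = a.x * b.y + a.y * b.x := rfl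

theorem zero_x : (0 : PellSolution).x = 1 := rfl

theorem zero_y : (0 : PellSolution).y = 0 := rfl

theorem neg_x (a : PellSolution) : (-a).x = a.x := rfl

theorem neg_y (a : PellSolution) : (-a).y = -a.y := rfl

/-- The group of solutions; `k • a` is the `k`-th multiple of `a` in it. -/
instance : AddCommGroup PellSolution where
  add_assoc a b c := by
    apply PellSolution.ext <;> simp only [add_x, add_y] <;> ring
  zero_add a := by
    apply PellSolution.ext <;> simp only [add_x, add_y, zero_x, zero_y] <;> ring
  add_zero a := by
    apply PellSolution.ext <;> simp only [add_x, add_y, zero_x, zero_y] <;> ring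
  nsmul := nsmulRec
  zsmul := zsmulRec
  neg_add_cancel a := by
    apply PellSolution.ext
    · simp only [add_x, neg_x, neg_y, zero_x]
      linear_combination a.pell
    · simp only [add_y, neg_x, neg_y, zero_y]
      ring
  add_comm a b := by
    apply PellSolution.ext <;> simp only [add_x, add_y] <;> ring

/-- Both components have order at most `ρ`. -/
def InBoundedOrder (ρ : ℝ) (a : PellSolution) : Prop :=
  a.x ∈ boundedOrder ρ ∧ a.y ∈ boundedOrder ρ

end PellSolution

end

/-!
The substitution `z = cosh u`, `w = sinh u` turns a solution `a = (x, y)` into the entire function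
`E u = x (cosh u) + y (cosh u) * sinh u`. It is `2 * π * I`-periodic, multiplicative in `a`, and
satisfies `E u * E (-u) = 1`, so it has no zeros. If `a` has order at most `ρ`, then `log ‖E u‖` is
`O (exp (σ * |Re u|))` for some `σ < ⌊ρ⌋ + 1`, hence `E u = exp (n * u + L (exp u))` with an integer
`n` and a Laurent polynomial `L` with exponents in `[-⌊ρ⌋, ⌊ρ⌋]`.

If `y_k` divides the second component of `k • a`, then `E u ^ (2 * k) = 1` whenever
`exp u ^ k = 1`. For a prime `p ∣ k` this forces `k / (π * I) * L` to take integer values at the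
`p`-th roots of unity. As `2 * ⌊ρ⌋ + 1 < p`, the exponents of `L` miss a nonzero residue class
modulo `p`, and the vanishing of the discrete Fourier coefficient there is an integer relation
between `p`-th roots of unity. Such a relation has equal coefficients, so `L` is constant on the
roots of unity and therefore constant. Thus `E u = ε * exp (n * u)` with `ε = ±1`, that is,
`a = ±(x_n, y_n)`, and `-y_n = y_{-n}`.
-/

section RootsOfUnity

variable {K : Type*} [Field K] {p : ℕ} {ζ : K}

theorem sum_primitiveRoot_zpow_mul (hζ : IsPrimitiveRoot ζ p) (l : ℤ) :
    ∑ r : Fin p, ζ ^ (l * (r : ℤ)) = if (p : ℤ) ∣ l then (p : K) else 0 := by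
  simp_rw [zpow_mul, zpow_natCast]
  split_ifs with hl
  · simp [(hζ.zpow_eq_one_iff_dvd l).2 hl]
  · rw [Fin.sum_univ_eq_sum_range (fun r => (ζ ^ l) ^ r) p,
      geom_sum_eq (mt (hζ.zpow_eq_one_iff_dvd l).1 hl), ← zpow_natCast, zpow_comm, zpow_natCast,
      hζ.pow_eq_one, one_zpow, sub_self, zero_div]

theorem sum_laurent_primitiveRoot_mul_zpow (hζ : IsPrimitiveRoot ζ p) (hp : p ≠ 0) (s : Finset ℤ)
    (a : ℤ → K) (i : ℤ) :
    ∑ r : Fin p, (∑ j ∈ s, a j * ζ ^ (j * (r : ℤ))) * (ζ ^ (-i)) ^ (r : ℕ) =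
      p * ∑ j ∈ s with (p : ℤ) ∣ j - i, a j := by
  calc
    _ = ∑ j ∈ s, a j * ∑ r : Fin p, ζ ^ ((j - i) * (r : ℤ)) := by
      simp_rw [Finset.sum_mul, Finset.mul_sum]
      rw [Finset.sum_comm]
      refine Finset.sum_congr rfl fun j _ => Finset.sum_congr rfl fun r _ => ?_
      rw [mul_assoc, ← zpow_natCast, ← zpow_mul, ← zpow_add₀ (hζ.ne_zero hp), sub_eq_add_neg,
        add_mul]
    _ = _ := by
      simp only [sum_primitiveRoot_zpow_mul hζ, mul_ite, mul_zero, Finset.sum_filter,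
        Finset.mul_sum, mul_comm]

/-- The vanishing coefficient at the missing residue class `t` is a `ℤ`-linear relation between the
`p`-th roots of unity, so the integer values must all agree. -/
theorem laurent_coeff_eq_zero_of_int_values [CharZero K] (hp : p.Prime) (hζ : IsPrimitiveRoot ζ p)
    {s : Finset ℤ} (hs : ∀ i ∈ s, ∀ j ∈ s, (p : ℤ) ∣ j - i → j = i) {t : ℤ} (ht : ¬ (p : ℤ) ∣ t)
    (hts : ∀ j ∈ s, ¬ (p : ℤ) ∣ j - t) {a : ℤ → K} {b : Fin p → ℤ}
    (hb : ∀ r : Fin p, ∑ j ∈ s, a j * ζ ^ (j * (r : ℤ)) = b r) {i : ℤ} (hi : i ∈ s)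
    (hpi : ¬ (p : ℤ) ∣ i) : a i = 0 := by
  have fourier := sum_laurent_primitiveRoot_mul_zpow hζ hp.ne_zero s a
  simp_rw [hb] at fourier
  have hconst : ∀ r r', b r = b r' := by
    have hprim : IsPrimitiveRoot (ζ ^ (-t)) p := by
      refine hζ.zpow_of_gcd_eq_one _ ?_
      rw [Int.neg_gcd, Int.gcd_comm, ← Int.isCoprime_iff_gcd_eq_one,
        (Nat.prime_iff_prime_int.1 hp).coprime_iff_not_dvd]
      exact ht
    rw [← hprim.sum_eq_zero_iff_forall_eq_int hp, fourier, Finset.filter_false_of_mem hts,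
      Finset.sum_empty, mul_zero]
  have hzero : ∑ r : Fin p, (b r : K) * (ζ ^ (-i)) ^ (r : ℕ) = 0 := by
    simp_rw [hconst _ ⟨0, hp.pos⟩, ← Finset.mul_sum, ← zpow_natCast, ← zpow_mul]
    rw [sum_primitiveRoot_zpow_mul hζ, if_neg (by rwa [dvd_neg]), mul_zero]
  have hsingle : ({j ∈ s | (p : ℤ) ∣ j - i} : Finset ℤ) = {i} := by
    ext j
    simp only [Finset.mem_filter, Finset.mem_singleton]
    exact ⟨fun hj => hs i hi j hj.1 hj.2, by rintro rfl; simp [hi]⟩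
  rw [fourier, hsingle, Finset.sum_singleton] at hzero
  exact (mul_eq_zero.1 hzero).resolve_left (Nat.cast_ne_zero.2 hp.ne_zero)

end RootsOfUnity

section ValuesAtRootsOfUnity

open Complex
open scoped Real

theorem exists_sum_eq_int_of_exp_pow_eq_one {p N : ℕ} (hN : N ≠ 0) (hpN : p ∣ N) {s : Finset ℤ}
    {n : ℤ} {a : ℤ → ℂ} {u : ℂ} (hu : exp u ^ p = 1)
    (h : exp (n * u + ∑ j ∈ s, a j * exp (j * u)) ^ N = 1) :
    ∃ c : ℤ, ∑ j ∈ s, N / (2 * π * I) * a j * exp u ^ j = c := by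
  have hn : exp (n * u) ^ N = 1 := by
    obtain ⟨q, rfl⟩ := hpN
    rw [exp_int_mul, pow_mul, ← zpow_natCast _ p, zpow_comm, zpow_natCast, hu, one_zpow, one_pow]
  rw [exp_add, mul_pow, hn, one_mul, ← exp_nat_mul, exp_eq_one_iff] at h
  obtain ⟨c, hc⟩ := h
  refine ⟨c, ?_⟩
  calc
    _ = N * (∑ j ∈ s, a j * exp (j * u)) / (2 * π * I) := by
      rw [Finset.mul_sum, Finset.sum_div]
      exact Finset.sum_congr rfl fun j _ => by rw [exp_int_mul]; ring
    _ = c := by rw [hc, mul_div_cancel_right₀ _ two_pi_I_ne_zero]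

theorem coeff_eq_zero_of_exp_pow_eq_one {p N d : ℕ} (hp : p.Prime) (hd : 2 * d + 1 < p)
    (hN : N ≠ 0) (hpN : p ∣ N) {n : ℤ} {a : ℤ → ℂ}
    (h : ∀ u : ℂ, exp u ^ p = 1 →
      exp (n * u + ∑ j ∈ Finset.Icc (-(d : ℤ)) d, a j * exp (j * u)) ^ N = 1)
    {i : ℤ} (hi : i ∈ Finset.Icc (-(d : ℤ)) d) (hi0 : i ≠ 0) : a i = 0 := by
  have hζ := isPrimitiveRoot_exp p hp.ne_zero
  have hint (r : Fin p) : ∃ c : ℤ, ∑ j ∈ Finset.Icc (-(d : ℤ)) d,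
      N / (2 * π * I) * a j * exp (2 * π * I / p) ^ (j * (r : ℤ)) = c := by
    have hu : exp (r * (2 * π * I / p)) ^ p = 1 := by
      rw [exp_nat_mul, pow_right_comm, hζ.pow_eq_one, one_pow]
    simpa only [exp_nat_mul, ← zpow_natCast, ← zpow_mul, mul_comm] using
      exists_sum_eq_int_of_exp_pow_eq_one hN hpN hu (h _ hu)
  choose c hc using hint
  have hndvd {l : ℤ} (hl : l ≠ 0) (hpl : -p < l) (hlp : l < p) : ¬ (p : ℤ) ∣ l :=
    fun hdvd => hl (Int.eq_zero_of_abs_lt_dvd hdvd (abs_lt.2 ⟨hpl, hlp⟩))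
  have hcoeff : N / (2 * π * I) * a i = 0 := by
    refine laurent_coeff_eq_zero_of_int_values hp hζ (t := d + 1) ?_ ?_ ?_ hc hi ?_ <;>
      simp only [Finset.mem_Icc] at *
    · intro i hi j hj hij
      by_contra hne
      exact hndvd (sub_ne_zero.2 hne) (by lia) (by lia) hij
    · exact hndvd (by lia) (by lia) (by lia)
    · exact fun j hj => hndvd (by lia) (by lia) (by lia)
    · exact hndvd hi0 (by lia) (by lia)
  exact (mul_eq_zero.1 hcoeff).resolve_left
    (div_ne_zero (Nat.cast_ne_zero.2 hN) two_pi_I_ne_zero)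

end ValuesAtRootsOfUnity

section LaurentExpansion

open Complex ComplexConjugate
open scoped Real

theorem integral_vertical_period_eq {f : ℂ → ℂ} (hf : Differentiable ℂ f)
    (hper : Function.Periodic f (2 * π * I)) (c : ℝ) :
    ∫ y in (0 : ℝ)..2 * π, f (c + y * I) = ∫ y in (0 : ℝ)..2 * π, f (y * I) := by
  have horiz (x : ℝ) : f (x + 2 * π * I) = f x := hper x
  have hrect := integral_boundary_rect_eq_zero_of_differentiableOn f 0 (c + (2 * π : ℝ) * I)
    hf.differentiableOn
  have hdiff : I * ((∫ y in (0 : ℝ)..2 * π, f (c + y * I)) -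
      ∫ y in (0 : ℝ)..2 * π, f (y * I)) = 0 := by
    simpa [horiz, mul_sub] using hrect
  exact sub_eq_zero.1 ((mul_eq_zero.1 hdiff).resolve_left I_ne_zero)

/-- The coefficient of `e ^ (j u)` in the expansion in powers of `e ^ u` of a
`2 * π * I`-periodic entire function `h`, computed on the segment `[0, 2 * π * I]`. -/
noncomputable def laurentCoeff (h : ℂ → ℂ) (j : ℤ) : ℂ :=
  (2 * π : ℂ)⁻¹ * ∫ y in (0 : ℝ)..2 * π, h (y * I) * exp (-j * (y * I))

theorem laurentCoeff_mul_exp {h : ℂ → ℂ} (hh : Differentiable ℂ h)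
    (hper : Function.Periodic h (2 * π * I)) (j : ℤ) (c : ℝ) :
    laurentCoeff h j * exp (j * c) =
      (2 * π : ℂ)⁻¹ * ∫ y in (0 : ℝ)..2 * π, h (c + y * I) * exp (-j * (y * I)) := by
  have hper' : Function.Periodic (fun u => h u * exp (-j * u)) (2 * π * I) := fun u => by
    have hperiod : -j * (u + 2 * π * I) = -j * u + (-j : ℤ) * (2 * π * I) := by push_cast; ring
    simp only [hper u, hperiod, exp_add, exp_int_mul_two_pi_mul_I, mul_one]
  rw [laurentCoeff, ← integral_vertical_period_eq (by fun_prop) hper' c, mul_assoc,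
    ← intervalIntegral.integral_mul_const]
  congr 1
  refine intervalIntegral.integral_congr fun y _ => ?_
  rw [mul_assoc, ← exp_add]
  ring_nf

theorem laurentCoeff_mul_exp_add_conj {h : ℂ → ℂ} (hh : Differentiable ℂ h)
    (hper : Function.Periodic h (2 * π * I)) (j : ℤ) (c : ℝ) :
    laurentCoeff h j * exp (j * c) + conj (laurentCoeff h (-j) * exp ((-j : ℤ) * c)) =
      (2 * π : ℂ)⁻¹ * ∫ y in (0 : ℝ)..2 * π, 2 * (h (c + y * I)).re * exp (-j * (y * I)) := by
  have hcont : Continuous h := hh.continuous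
  rw [laurentCoeff_mul_exp hh hper, laurentCoeff_mul_exp hh hper, map_mul,
    ← intervalIntegral.intervalIntegral_conj]
  simp only [map_inv₀, map_mul, conj_ofReal, map_ofNat]
  rw [← mul_add, ← intervalIntegral.integral_add
    (Continuous.intervalIntegrable (by fun_prop) _ _)
    (Continuous.intervalIntegrable (by fun_prop) _ _)]
  congr 1
  refine intervalIntegral.integral_congr fun y _ => ?_
  simp only [← exp_conj, map_mul, map_neg, map_intCast, conj_ofReal, conj_I, Int.cast_neg]
  rw [← ofReal_ofNat, ← ofReal_mul, ← add_conj]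
  ring_nf

theorem norm_laurentCoeff_mul_exp_le {h : ℂ → ℂ} (hh : Differentiable ℂ h)
    (hper : Function.Periodic h (2 * π * I)) {B c : ℝ}
    (hB : ∀ y : ℝ, |(h (c + y * I)).re| ≤ B) (j : ℤ) :
    ‖laurentCoeff h j‖ * Real.exp (j * c) ≤
      ‖laurentCoeff h (-j)‖ * Real.exp (-(j * c)) + 2 * B := by
  have hint : ‖∫ y in (0 : ℝ)..2 * π, 2 * (h (c + y * I)).re * exp (-j * (y * I))‖ ≤
      2 * B * |2 * π - 0| := by
    refine intervalIntegral.norm_integral_le_of_norm_le_const fun y _ => ?_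
    have hunit : ‖exp (-j * (y * I))‖ = 1 := by simp [norm_exp]
    rw [norm_mul, hunit, mul_one, norm_mul, norm_real, norm_ofNat]
    gcongr
    exact hB y
  have hsum : ‖laurentCoeff h j * exp (j * c) +
      conj (laurentCoeff h (-j) * exp ((-j : ℤ) * c))‖ ≤ 2 * B := by
    rw [laurentCoeff_mul_exp_add_conj hh hper, norm_mul]
    calc
      _ ≤ ‖(2 * π : ℂ)⁻¹‖ * (2 * B * |2 * π - 0|) := by gcongr
      _ = 2 * B := by
        rw [norm_inv, norm_mul, norm_ofNat, norm_real, Real.norm_of_nonneg Real.pi_pos.le, sub_zero,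
          abs_of_pos Real.two_pi_pos, mul_comm, mul_inv_cancel_right₀ Real.two_pi_pos.ne']
  have hnorm (i : ℤ) : ‖laurentCoeff h i * exp (i * c)‖ =
      ‖laurentCoeff h i‖ * Real.exp (i * c) := by
    simp [norm_exp]
  have htri := norm_sub_le_norm_add (laurentCoeff h j * exp (j * c))
    (conj (laurentCoeff h (-j) * exp ((-j : ℤ) * c)))
  rw [RCLike.norm_conj, hnorm, hnorm, Int.cast_neg, neg_mul] at htri
  linarith

theorem laurentCoeff_eq_zero {h : ℂ → ℂ} (hh : Differentiable ℂ h)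
    (hper : Function.Periodic h (2 * π * I)) {B σ : ℝ}
    (hB : ∀ u : ℂ, |(h u).re| ≤ B * Real.exp (σ * |u.re|)) {j : ℤ} (hj0 : j ≠ 0)
    (hj : σ < |(j : ℝ)|) : laurentCoeff h j = 0 := by
  have hbound (x : ℝ) (hx : 0 ≤ x) : ‖laurentCoeff h j‖ ≤
      ‖laurentCoeff h (-j)‖ * Real.exp (-(2 * |(j : ℝ)|) * x) +
        2 * B * Real.exp (-(|(j : ℝ)| - σ) * x) := by
    obtain ⟨c, hjc, hc⟩ : ∃ c : ℝ, j * c = |(j : ℝ)| * x ∧ |c| = x := by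
      rcases le_total 0 (j : ℝ) with h0 | h0
      · exact ⟨x, by rw [abs_of_nonneg h0], abs_of_nonneg hx⟩
      · exact ⟨-x, by rw [abs_of_nonpos h0]; ring, by rw [abs_neg, abs_of_nonneg hx]⟩
    have hle := norm_laurentCoeff_mul_exp_le hh hper (c := c) (B := B * Real.exp (σ * x))
      (fun y => by simpa [hc] using hB (c + y * I)) j
    rw [hjc, ← le_div_iff₀ (Real.exp_pos _)] at hle
    refine hle.trans_eq ?_
    rw [add_div, mul_div_assoc, ← Real.exp_sub, ← mul_assoc, mul_div_assoc, ← Real.exp_sub]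
    ring_nf
  have hexp {κ : ℝ} (hκ : 0 < κ) : Tendsto (fun x : ℝ => Real.exp (-κ * x)) atTop (nhds 0) :=
    Real.tendsto_exp_atBot.comp (tendsto_id.const_mul_atTop_of_neg (neg_lt_zero.2 hκ))
  have hlim := ((hexp (κ := 2 * |(j : ℝ)|) (by positivity)).const_mul ‖laurentCoeff h (-j)‖).add
    ((hexp (sub_pos.2 hj)).const_mul (2 * B))
  rw [mul_zero, mul_zero, add_zero] at hlim
  exact norm_le_zero_iff.1
    (ge_of_tendsto hlim ((eventually_ge_atTop 0).mono hbound))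

theorem fourierCoeff_eq_laurentCoeff_mul_exp [Fact (0 < 2 * π)] {h : ℂ → ℂ}
    (hh : Differentiable ℂ h) (hper : Function.Periodic h (2 * π * I)) {c : ℝ}
    {F : C(AddCircle (2 * π), ℂ)} (hF : ∀ y : ℝ, F y = h (c + y * I)) (j : ℤ) :
    fourierCoeff F j = laurentCoeff h j * exp (j * c) := by
  rw [fourierCoeff_eq_intervalIntegral F j 0, zero_add, laurentCoeff_mul_exp hh hper, real_smul]
  congr 1
  · push_cast; rw [one_div]
  · refine intervalIntegral.integral_congr fun y _ => ?_
    simp only [hF, fourier_coe_apply, smul_eq_mul]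
    rw [mul_comm]
    congr 2
    push_cast
    field_simp

theorem eq_sum_laurentCoeff {h : ℂ → ℂ} (hh : Differentiable ℂ h)
    (hper : Function.Periodic h (2 * π * I)) {s : Finset ℤ} (hs : ∀ j ∉ s, laurentCoeff h j = 0)
    (u : ℂ) : h u = ∑ j ∈ s, laurentCoeff h j * exp (j * u) := by
  have : Fact (0 < 2 * π) := ⟨Real.two_pi_pos⟩
  have hperIm : Function.Periodic (fun y : ℝ => h (u.re + y * I)) (2 * π) := fun y => by
    simpa [add_mul, add_assoc] using hper (u.re + y * I)
  let F : C(AddCircle (2 * π), ℂ) :=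
    ⟨hperIm.lift, continuous_coinduced_dom.2 (hh.continuous.comp (by fun_prop))⟩
  have hF (y : ℝ) : F y = h (u.re + y * I) := rfl
  have hcoeff := fourierCoeff_eq_laurentCoeff_mul_exp hh hper hF
  have hzero : ∀ j ∉ s, fourierCoeff F j = 0 := fun j hj => by rw [hcoeff, hs j hj, zero_mul]
  have hseries := (has_pointwise_sum_fourier_series_of_summable
    (summable_of_ne_finset_zero hzero) u.im).unique
      (hasSum_sum_of_ne_finset_zero fun j hj => by rw [hzero j hj, zero_smul])
  rw [hF, re_add_im] at hseries
  refine hseries.trans (Finset.sum_congr rfl fun j _ => ?_)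
  have hexp : exp (j * u) = exp (j * u.re + j * (u.im * I)) := by rw [← mul_add, re_add_im]
  rw [hcoeff, fourier_coe_apply, smul_eq_mul, mul_assoc, ← exp_add, hexp]
  congr 3
  push_cast
  field_simp

theorem exists_eq_laurent_of_abs_re_le {h : ℂ → ℂ} (hh : Differentiable ℂ h)
    (hper : Function.Periodic h (2 * π * I)) {B σ : ℝ}
    (hB : ∀ u : ℂ, |(h u).re| ≤ B * Real.exp (σ * |u.re|)) {d : ℕ} (hd : σ < d + 1) :
    ∃ a : ℤ → ℂ, ∀ u, h u = ∑ j ∈ Finset.Icc (-(d : ℤ)) d, a j * exp (j * u) := by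
  refine ⟨laurentCoeff h, eq_sum_laurentCoeff hh hper fun j hj => ?_⟩
  have hdj : (d : ℤ) + 1 ≤ |j| := by
    by_contra hlt
    exact hj (Finset.mem_Icc.2 (abs_le.1 (by lia)))
  refine laurentCoeff_eq_zero hh hper hB (abs_pos.1 (by lia)) (hd.trans_le ?_)
  exact_mod_cast hdj

end LaurentExpansion

section Logarithm

open Complex
open scoped Real

theorem exists_entire_log {G : ℂ → ℂ} (hG : Differentiable ℂ G) (hG0 : ∀ u, G u ≠ 0) :
    ∃ L : ℂ → ℂ, Differentiable ℂ L ∧ ∀ u, G u = exp (L u) := by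
  have hG' : Differentiable ℂ (deriv G) := by
    simpa using (hG.contDiff (n := 2)).differentiable_deriv_two
  obtain ⟨L, hL0, hL⟩ := (hG'.div hG hG0).isExactOn_univ.with_val_at 0 (log (G 0))
  have hderiv (v : ℂ) : HasDerivAt (fun v => G v * exp (-L v)) 0 v := by
    refine ((hG v).hasDerivAt.mul (hL v trivial).neg.cexp).congr_deriv ?_
    simp only [Pi.div_apply, Pi.neg_apply]
    field_simp [hG0 v]
    ring
  refine ⟨L, fun u => (hL u trivial).differentiableAt, fun u => ?_⟩
  have hconst : G u * exp (-L u) = G 0 * exp (-L 0) :=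
    is_const_of_deriv_eq_zero (fun v => (hderiv v).differentiableAt)
      (fun v => (hderiv v).deriv) u 0
  rw [hL0, exp_neg (log _), exp_log (hG0 0), mul_inv_cancel₀ (hG0 0), exp_neg] at hconst
  exact (mul_inv_eq_one₀ (exp_ne_zero _)).1 hconst

theorem exists_int_eq_add_of_exp_eq {f g : ℂ → ℂ} (hf : Differentiable ℂ f)
    (hg : Differentiable ℂ g) (h : ∀ u, exp (f u) = exp (g u)) :
    ∃ n : ℤ, ∀ u, f u = g u + n * (2 * π * I) := by
  have hderiv (v : ℂ) : deriv f v = deriv g v := by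
    have hexp := (hf v).hasDerivAt.cexp
    rw [funext h, h] at hexp
    exact mul_left_cancel₀ (exp_ne_zero _) (hexp.unique (hg v).hasDerivAt.cexp)
  have hconst (u : ℂ) : f u - g u = f 0 - g 0 :=
    is_const_of_deriv_eq_zero (hf.sub hg)
      (fun v => by rw [deriv_sub (hf v) (hg v), hderiv, sub_self]) u 0
  obtain ⟨n, hn⟩ := exp_eq_exp_iff_exists_int.1 (h 0)
  exact ⟨n, fun u => by linear_combination hconst u + hn⟩

theorem exists_periodic_log {G : ℂ → ℂ} (hG : Differentiable ℂ G) (hG0 : ∀ u, G u ≠ 0)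
    (hper : Function.Periodic G (2 * π * I)) :
    ∃ (n : ℤ) (h : ℂ → ℂ), Differentiable ℂ h ∧ Function.Periodic h (2 * π * I) ∧
      ∀ u, G u = exp (n * u + h u) := by
  obtain ⟨L, hL, hGL⟩ := exists_entire_log hG hG0
  obtain ⟨n, hn⟩ := exists_int_eq_add_of_exp_eq (f := fun u => L (u + 2 * π * I)) (by fun_prop) hL
    fun u => by rw [← hGL, ← hGL, hper]
  refine ⟨n, fun u => L u - n * u, by fun_prop, fun u => ?_, fun u => ?_⟩
  · linear_combination hn u
  · rw [hGL, add_sub_cancel]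

theorem abs_le_exp_mul_abs_div {σ : ℝ} (hσ : 0 < σ) (x : ℝ) : |x| ≤ Real.exp (σ * |x|) / σ := by
  rw [le_div_iff₀ hσ, mul_comm]
  exact (lt_add_one _).le.trans (Real.add_one_le_exp _)

theorem exists_eq_exp_laurent {G : ℂ → ℂ} (hG : Differentiable ℂ G) (hG0 : ∀ u, G u ≠ 0)
    (hper : Function.Periodic G (2 * π * I)) {B σ : ℝ} (hσ : 0 < σ)
    (hB : ∀ u, |Real.log ‖G u‖| ≤ B * Real.exp (σ * |u.re|)) {d : ℕ} (hd : σ < d + 1) :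
    ∃ (n : ℤ) (a : ℤ → ℂ), ∀ u,
      G u = exp (n * u + ∑ j ∈ Finset.Icc (-(d : ℤ)) d, a j * exp (j * u)) := by
  obtain ⟨n, h, hh, hhper, hGh⟩ := exists_periodic_log hG hG0 hper
  have hbound (u : ℂ) : |(h u).re| ≤ (B + |(n : ℝ)| / σ) * Real.exp (σ * |u.re|) := by
    have hre : (h u).re = Real.log ‖G u‖ - n * u.re := by
      simp [hGh, norm_exp]
    calc
      |(h u).re| ≤ |Real.log ‖G u‖| + |(n : ℝ)| * |u.re| := by
        rw [hre, ← abs_mul]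
        exact abs_sub _ _
      _ ≤ B * Real.exp (σ * |u.re|) + |(n : ℝ)| * (Real.exp (σ * |u.re|) / σ) := by
        gcongr
        exacts [hB u, abs_le_exp_mul_abs_div hσ _]
      _ = _ := by ring
  obtain ⟨a, ha⟩ := exists_eq_laurent_of_abs_re_le hh hhper hbound hd
  exact ⟨n, a, fun u => by rw [hGh, ha]⟩

end Logarithm

section Growth

namespace Entire

theorem bddAbove_norm_image_closedBall (f : Entire) (r : ℝ) :
    BddAbove ((fun z : ℂ => ‖f.1 z‖) '' Metric.closedBall 0 r) :=
  ((isCompact_closedBall 0 r).image (Differentiable.continuous f.2).norm).bddAbove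

theorem norm_le_maxModulus (f : Entire) {z : ℂ} {r : ℝ} (hz : ‖z‖ ≤ r) :
    ‖f.1 z‖ ≤ maxModulus f r :=
  le_csSup (bddAbove_norm_image_closedBall f r) ⟨z, by simpa using hz, rfl⟩

theorem maxModulus_mono (f : Entire) {r s : ℝ} (hr : 0 ≤ r) (hrs : r ≤ s) :
    maxModulus f r ≤ maxModulus f s :=
  csSup_le_csSup (bddAbove_norm_image_closedBall f s)
    ((Metric.nonempty_closedBall.2 hr).image _)
    (Set.image_mono (Metric.closedBall_subset_closedBall hrs))

theorem exists_log_maxModulus_le {f : Entire} {σ : ℝ≥0}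
    (hσ : growthOrder f < σ) :
    ∃ C : ℝ, 0 ≤ C ∧ ∀ᶠ r : ℝ in atTop, Real.log (maxModulus f r) ≤ C * r ^ (σ : ℝ) := by
  simp only [growthOrder, iInf_lt_iff, ENNReal.coe_lt_coe] at hσ
  obtain ⟨α, ⟨C, hC⟩, hα⟩ := hσ
  refine ⟨max C 0, le_max_right _ _, ?_⟩
  filter_upwards [hC, eventually_ge_atTop 1] with r hr hr1
  calc
    _ ≤ C * r ^ (α : ℝ) := hr
    _ ≤ max C 0 * r ^ (σ : ℝ) := by
      gcongr
      exact le_max_left _ _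

theorem exists_maxModulus_le_exp_rpow {ρ σ : ℝ} (hρσ : ρ < σ) (hσ : 0 < σ) {f : Entire}
    (hf : f ∈ boundedOrder ρ) :
    ∃ C : ℝ, 0 ≤ C ∧ ∀ R : ℝ, 1 ≤ R → maxModulus f R ≤ Real.exp (C * R ^ σ) := by
  have hlt : growthOrder f < ENNReal.ofReal σ :=
    hf.trans_lt ((ENNReal.ofReal_lt_ofReal_iff hσ).2 hρσ)
  obtain ⟨C, hC, hev⟩ := exists_log_maxModulus_le hlt
  rw [Real.coe_toNNReal σ hσ.le] at hev
  obtain ⟨R₀, hR₀⟩ := eventually_atTop.1 hev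
  refine ⟨max C (maxModulus f R₀), hC.trans (le_max_left _ _), fun R hR => ?_⟩
  have hRσ : 1 ≤ R ^ σ := Real.one_le_rpow hR hσ.le
  rcases le_total R₀ R with hle | hle
  · calc
      _ ≤ Real.exp (Real.log (maxModulus f R)) := Real.le_exp_log _
      _ ≤ Real.exp (C * R ^ σ) := Real.exp_le_exp.2 (hR₀ R hle)
      _ ≤ _ := by
        gcongr
        exact le_max_left _ _
  · calc
      _ ≤ maxModulus f R₀ := maxModulus_mono f (zero_le_one.trans hR) hle
      _ ≤ max C (maxModulus f R₀) * 1 := by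
        rw [mul_one]
        exact le_max_right _ _
      _ ≤ max C (maxModulus f R₀) * R ^ σ := by
        gcongr
      _ ≤ _ := (lt_add_one _).le.trans (Real.add_one_le_exp _)

end Entire

theorem maxModulus_polyEntire_le (P : ℂ[X]) {r : ℝ} (hr : 1 ≤ r) :
    maxModulus (polyEntire P) r ≤
      (∑ i ∈ Finset.range (P.natDegree + 1), ‖P.coeff i‖) * r ^ P.natDegree := by
  refine csSup_le ((Metric.nonempty_closedBall.2 (zero_le_one.trans hr)).image _) ?_
  rintro _ ⟨z, hz, rfl⟩
  rw [mem_closedBall_zero_iff] at hz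
  calc
    ‖P.eval z‖ ≤ ∑ i ∈ Finset.range (P.natDegree + 1), ‖P.coeff i * z ^ i‖ := by
      rw [eval_eq_sum_range]
      exact norm_sum_le _ _
    _ ≤ ∑ i ∈ Finset.range (P.natDegree + 1), ‖P.coeff i‖ * r ^ P.natDegree := by
      refine Finset.sum_le_sum fun i hi => ?_
      rw [norm_mul, norm_pow]
      gcongr
      calc
        ‖z‖ ^ i ≤ r ^ i := by gcongr
        _ ≤ r ^ P.natDegree := pow_le_pow_right₀ hr (Finset.mem_range_succ_iff.1 hi)
    _ = _ := (Finset.sum_mul _ _ _).symm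

theorem eventually_log_maxModulus_polyEntire_le (P : ℂ[X]) {α : ℝ} (hα : 0 < α) :
    ∀ᶠ r : ℝ in atTop, Real.log (maxModulus (polyEntire P) r) ≤ 1 * r ^ α := by
  set A := 1 + ∑ i ∈ Finset.range (P.natDegree + 1), ‖P.coeff i‖
  have hA : 1 ≤ A := le_add_of_nonneg_right (by positivity)
  have hlittle : (fun r : ℝ => Real.log A + P.natDegree * Real.log r) =o[atTop]
      fun r => r ^ α :=
    (Asymptotics.isLittleO_const_left.2
      (Or.inr (tendsto_norm_atTop_atTop.comp (tendsto_rpow_atTop hα)))).add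
      ((isLittleO_log_rpow_atTop hα).const_mul_left _)
  filter_upwards [hlittle.bound one_pos, eventually_ge_atTop 1] with r hr hr1
  have hr0 : 0 < r := one_pos.trans_le hr1
  calc
    Real.log (maxModulus (polyEntire P) r) ≤ Real.log (A * r ^ P.natDegree) := by
      rcases le_or_gt (maxModulus (polyEntire P) r) 0 with hM | hM
      · have hM0 : maxModulus (polyEntire P) r = 0 := hM.antisymm
          ((norm_nonneg _).trans (Entire.norm_le_maxModulus _ (norm_zero.trans_le hr0.le)))
        rw [hM0, Real.log_zero]
        exact Real.log_nonneg (one_le_mul_of_one_le_of_one_le hA (one_le_pow₀ hr1))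
      · refine Real.log_le_log hM ((maxModulus_polyEntire_le P hr1).trans ?_)
        gcongr
        exact le_add_of_nonneg_left zero_le_one
    _ = Real.log A + P.natDegree * Real.log r := by
      rw [Real.log_mul (by positivity) (by positivity), Real.log_pow]
    _ ≤ ‖Real.log A + P.natDegree * Real.log r‖ := le_abs_self _
    _ ≤ 1 * r ^ α := by rwa [Real.norm_of_nonneg (Real.rpow_nonneg hr0.le α)] at hr

theorem growthOrder_polyEntire (P : ℂ[X]) : growthOrder (polyEntire P) = 0 := by
  refine nonpos_iff_eq_zero.1 (le_of_forall_gt fun c hc => ?_)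
  obtain ⟨α, hα, hαc⟩ := ENNReal.lt_iff_exists_nnreal_btwn.1 hc
  exact (iInf₂_le α ⟨1, eventually_log_maxModulus_polyEntire_le P
    (NNReal.coe_pos.2 (ENNReal.coe_pos.1 hα))⟩).trans_lt hαc

theorem polyEntire_mem_boundedOrder (ρ : ℝ) (P : ℂ[X]) : polyEntire P ∈ boundedOrder ρ :=
  (growthOrder_polyEntire P).trans_le zero_le

end Growth

section HyperbolicSubstitution

open Complex
open scoped Real

theorem cosh_surjective : Function.Surjective cosh := fun z => by
  obtain ⟨v, rfl⟩ := cos_surjective z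
  exact ⟨v * I, cosh_mul_I v⟩

theorem norm_cosh_le (u : ℂ) : ‖cosh u‖ ≤ Real.exp |u.re| := by
  have hpos : Real.exp u.re ≤ Real.exp |u.re| := Real.exp_le_exp.2 (le_abs_self _)
  have hneg : Real.exp (-u.re) ≤ Real.exp |u.re| := Real.exp_le_exp.2 (neg_le_abs _)
  have htri := norm_add_le (exp u) (exp (-u))
  rw [norm_exp, norm_exp, neg_re] at htri
  rw [cosh, norm_div, norm_ofNat, div_le_iff₀ two_pos]
  linarith

theorem norm_sinh_le (u : ℂ) : ‖sinh u‖ ≤ Real.exp |u.re| := by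
  have hpos : Real.exp u.re ≤ Real.exp |u.re| := Real.exp_le_exp.2 (le_abs_self _)
  have hneg : Real.exp (-u.re) ≤ Real.exp |u.re| := Real.exp_le_exp.2 (neg_le_abs _)
  have htri := norm_sub_le (exp u) (exp (-u))
  rw [norm_exp, norm_exp, neg_re] at htri
  rw [sinh, norm_div, norm_ofNat, div_le_iff₀ two_pos]
  linarith

theorem eq_of_comp_cosh_mul_sinh_eq {f g : ℂ → ℂ} (hf : Continuous f) (hg : Continuous g)
    (h : ∀ u, f (cosh u) * sinh u = g (cosh u) * sinh u) : f = g := by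
  refine Continuous.ext_on (s := {1, -1}ᶜ) ((Set.toFinite _).countable.dense_compl ℂ) hf hg
    fun z hz => ?_
  obtain ⟨u, rfl⟩ := cosh_surjective z
  refine mul_right_cancel₀ (fun hsinh => hz ?_) (h u)
  have hsq := cosh_sq_sub_sinh_sq u
  rw [hsinh, zero_pow two_ne_zero, sub_zero, sq] at hsq
  exact mul_self_eq_one_iff.1 hsq

theorem exp_add_exp_mul_exp_le {a b c : ℝ} (ha : 0 ≤ a) (hb : 0 ≤ b) (hc : 0 ≤ c) :
    Real.exp a + Real.exp b * Real.exp c ≤ Real.exp (a + b + c + 1) :=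
  calc
    _ ≤ Real.exp (a + b + c) + Real.exp (a + b + c) := by
      rw [← Real.exp_add]
      gcongr <;> linarith
    _ = Real.exp (a + b + c) * 2 := (mul_two _).symm
    _ ≤ Real.exp (a + b + c) * Real.exp 1 := by
      gcongr
      linarith [Real.add_one_le_exp 1]
    _ = _ := (Real.exp_add _ _).symm

namespace PellSolution

/-- The value of `x + y w` under the uniformization `z = cosh u`, `w = sinh u` of the curve
`w ^ 2 = z ^ 2 - 1`. -/
noncomputable def hypEval (a : PellSolution) (u : ℂ) : ℂ :=
  a.x.1 (cosh u) + a.y.1 (cosh u) * sinh u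

theorem hypEval_zero (u : ℂ) : hypEval 0 u = 1 := by
  simp [hypEval, zero_x, zero_y]

theorem hypEval_add (a b : PellSolution) (u : ℂ) :
    (a + b).hypEval u = a.hypEval u * b.hypEval u := by
  simp only [hypEval, add_x, add_y, coordZ, polyEntire, Subring.coe_add, Subring.coe_mul,
    AddSubgroupClass.coe_sub, Subring.coe_pow, Subring.coe_one, Pi.add_apply, Pi.mul_apply,
    Pi.sub_apply, Pi.pow_apply, Pi.one_apply, eval_X]
  linear_combination a.y.1 (cosh u) * b.y.1 (cosh u) * cosh_sq_sub_sinh_sq u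

/-- `hypEval` at a fixed point as a homomorphism, so that multiples are evaluated by `map_zpow`. -/
noncomputable def hypEvalHom (u : ℂ) : Multiplicative PellSolution →* ℂ where
  toFun a := a.toAdd.hypEval u
  map_one' := hypEval_zero u
  map_mul' a b := hypEval_add a.toAdd b.toAdd u

theorem hypEval_zsmul (n : ℤ) (a : PellSolution) (u : ℂ) :
    (n • a).hypEval u = a.hypEval u ^ n :=
  map_zpow (hypEvalHom u) (Multiplicative.ofAdd a) n

theorem hypEval_nsmul (k : ℕ) (a : PellSolution) (u : ℂ) :
    (k • a).hypEval u = a.hypEval u ^ k :=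
  map_pow (hypEvalHom u) (Multiplicative.ofAdd a) k

theorem hypEval_neg_arg (a : PellSolution) (u : ℂ) : a.hypEval (-u) = (-a).hypEval u := by
  simp [hypEval, neg_x, neg_y]

theorem hypEval_mul_hypEval_neg (a : PellSolution) (u : ℂ) :
    a.hypEval u * a.hypEval (-u) = 1 := by
  rw [hypEval_neg_arg, ← hypEval_add, add_neg_cancel, hypEval_zero]

theorem hypEval_ne_zero (a : PellSolution) (u : ℂ) : a.hypEval u ≠ 0 :=
  left_ne_zero_of_mul_eq_one (hypEval_mul_hypEval_neg a u)

theorem hypEval_periodic (a : PellSolution) :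
    Function.Periodic a.hypEval (2 * π * I) := fun u => by
  simp only [hypEval, cosh_periodic u, sinh_periodic u]

theorem differentiable_hypEval (a : PellSolution) : Differentiable ℂ a.hypEval :=
  (Differentiable.comp a.x.2 differentiable_cosh).add
    ((Differentiable.comp a.y.2 differentiable_cosh).mul differentiable_sinh)

theorem y_cosh_mul_sinh (a : PellSolution) (u : ℂ) :
    a.y.1 (cosh u) * sinh u = (a.hypEval u - a.hypEval (-u)) / 2 := by
  rw [hypEval, hypEval, cosh_neg, sinh_neg]
  ring

theorem y_eq_smul_of_hypEval_eq_mul {a b : PellSolution} {ε : ℂ}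
    (h : ∀ u, a.hypEval u = ε * b.hypEval u) : a.y.1 = ε • b.y.1 := by
  refine eq_of_comp_cosh_mul_sinh_eq (Differentiable.continuous a.y.2)
    ((Differentiable.continuous b.y.2).const_smul ε) fun u => ?_
  rw [Pi.smul_apply, smul_mul_assoc, y_cosh_mul_sinh, y_cosh_mul_sinh, h, h, smul_eq_mul]
  ring

theorem exists_norm_hypEval_le {ρ σ : ℝ} (hρσ : ρ < σ) (hσ : 0 < σ) {a : PellSolution}
    (ha : a.InBoundedOrder ρ) :
    ∃ B : ℝ, ∀ u, ‖a.hypEval u‖ ≤ Real.exp (B * Real.exp (σ * |u.re|)) := by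
  obtain ⟨C, hC, hx⟩ := Entire.exists_maxModulus_le_exp_rpow hρσ hσ ha.1
  obtain ⟨D, hD, hy⟩ := Entire.exists_maxModulus_le_exp_rpow hρσ hσ ha.2
  refine ⟨C + D + 1 / σ + 1, fun u => ?_⟩
  have hR : 1 ≤ Real.exp |u.re| := Real.one_le_exp (abs_nonneg _)
  have hpow : Real.exp |u.re| ^ σ = Real.exp (σ * |u.re|) := by rw [← Real.exp_mul, mul_comm]
  have hx' := (Entire.norm_le_maxModulus a.x (norm_cosh_le u)).trans (hx _ hR)
  have hy' := (Entire.norm_le_maxModulus a.y (norm_cosh_le u)).trans (hy _ hR)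
  rw [hpow] at hx' hy'
  have hE : 1 ≤ Real.exp (σ * |u.re|) := Real.one_le_exp (by positivity)
  calc
    ‖a.hypEval u‖ ≤ ‖a.x.1 (cosh u)‖ + ‖a.y.1 (cosh u)‖ * ‖sinh u‖ := by
      rw [← norm_mul]
      exact norm_add_le _ _
    _ ≤ Real.exp (C * Real.exp (σ * |u.re|)) +
        Real.exp (D * Real.exp (σ * |u.re|)) * Real.exp (Real.exp (σ * |u.re|) / σ) := by
      gcongr
      exact (norm_sinh_le u).trans (Real.exp_le_exp.2 (abs_le_exp_mul_abs_div hσ _))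
    _ ≤ Real.exp (C * Real.exp (σ * |u.re|) + D * Real.exp (σ * |u.re|) +
        Real.exp (σ * |u.re|) / σ + 1) :=
      exp_add_exp_mul_exp_le (by positivity) (by positivity) (by positivity)
    _ ≤ Real.exp ((C + D + 1 / σ + 1) * Real.exp (σ * |u.re|)) := by
      rw [Real.exp_le_exp, add_mul, add_mul, add_mul, one_div_mul_eq_div, one_mul]
      gcongr

theorem exists_abs_log_norm_hypEval_le {ρ σ : ℝ} (hρσ : ρ < σ) (hσ : 0 < σ) {a : PellSolution}
    (ha : a.InBoundedOrder ρ) :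
    ∃ B : ℝ, ∀ u, |Real.log ‖a.hypEval u‖| ≤ B * Real.exp (σ * |u.re|) := by
  obtain ⟨B, hB⟩ := exists_norm_hypEval_le hρσ hσ ha
  have hlog (u : ℂ) : Real.log ‖a.hypEval u‖ ≤ B * Real.exp (σ * |u.re|) :=
    (Real.log_le_iff_le_exp (norm_pos_iff.2 (a.hypEval_ne_zero u))).2 (hB u)
  refine ⟨B, fun u => abs_le'.2 ⟨hlog u, ?_⟩⟩
  have hinv : a.hypEval (-u) = (a.hypEval u)⁻¹ :=
    eq_inv_of_mul_eq_one_right (a.hypEval_mul_hypEval_neg u)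
  simpa [hinv] using hlog (-u)

theorem InBoundedOrder.exists_hypEval_eq_exp_laurent {ρ : ℝ} (hρ : 0 ≤ ρ) {a : PellSolution}
    (ha : a.InBoundedOrder ρ) :
    ∃ (n : ℤ) (c : ℤ → ℂ), ∀ u, a.hypEval u =
      exp (n * u + ∑ j ∈ Finset.Icc (-(⌊ρ⌋₊ : ℤ)) ⌊ρ⌋₊, c j * exp (j * u)) := by
  obtain ⟨σ, hρσ, hσ⟩ := exists_between (Nat.lt_floor_add_one ρ)
  have hσ0 : 0 < σ := hρ.trans_lt hρσ
  obtain ⟨B, hB⟩ := exists_abs_log_norm_hypEval_le hρσ hσ0 ha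
  exact exists_eq_exp_laurent a.differentiable_hypEval a.hypEval_ne_zero a.hypEval_periodic hσ0 hB
    hσ

end PellSolution

end HyperbolicSubstitution

section PolynomialSolutions

/-- `polyEntire` as a ring homomorphism, which carries polynomial identities over to `Entire`. -/
noncomputable def polyEntireHom : ℂ[X] →+* Entire where
  toFun := polyEntire
  map_one' := Subtype.ext (funext fun _ => eval_one)
  map_mul' _ _ := Subtype.ext (funext fun _ => eval_mul)
  map_zero' := Subtype.ext (funext fun _ => eval_zero)
  map_add' _ _ := Subtype.ext (funext fun _ => eval_add)

theorem polyEntire_injective : Function.Injective polyEntire := fun _ _ h =>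
  Polynomial.funext fun z => congrFun (congrArg Subtype.val h) z

theorem pellX_sq_sub_mul_pellY_sq (n : ℤ) :
    pellX n ^ 2 - (X ^ 2 - 1) * pellY n ^ 2 = 1 := by
  have hunit : Units.map (QuadraticAlgebra.norm : _ →* ℂ[X]) zAddW = 1 := by
    ext1
    change QuadraticAlgebra.norm (⟨X, 1⟩ : QuadraticAlgebra ℂ[X] (X ^ 2 - 1) 0) = 1
    rw [QuadraticAlgebra.norm_def]
    ring
  have hnorm : QuadraticAlgebra.norm ((zAddW ^ n : (QuadraticAlgebra ℂ[X] (X ^ 2 - 1) 0)ˣ) :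
      QuadraticAlgebra ℂ[X] (X ^ 2 - 1) 0) = 1 := by
    rw [← Units.coe_map, map_zpow, hunit, one_zpow, Units.val_one]
  rw [QuadraticAlgebra.norm_def] at hnorm
  rw [pellX, pellY]
  linear_combination hnorm

theorem pellX_add (m n : ℤ) :
    pellX (m + n) = pellX m * pellX n + (X ^ 2 - 1) * pellY m * pellY n := by
  simp only [pellX, pellY, zpow_add, Units.val_mul, QuadraticAlgebra.re_mul]

theorem pellY_add (m n : ℤ) : pellY (m + n) = pellX m * pellY n + pellY m * pellX n := by
  simp only [pellX, pellY, zpow_add, Units.val_mul, QuadraticAlgebra.im_mul, zero_mul, add_zero]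

/-- The solutions `(x_n, y_n)`, as a homomorphism in `n`. -/
noncomputable def polySolution : ℤ →+ PellSolution :=
  AddMonoidHom.mk'
    (fun n =>
      { x := polyEntire (pellX n)
        y := polyEntire (pellY n)
        pell := by
          have h := congrArg polyEntireHom (pellX_sq_sub_mul_pellY_sq n)
          simp only [map_sub, map_mul, map_pow, map_one] at h
          exact h })
    fun m n => by
      have hx := congrArg polyEntireHom (pellX_add m n)
      have hy := congrArg polyEntireHom (pellY_add m n)
      simp only [map_sub, map_add, map_mul, map_pow, map_one] at hx hy
      exact PellSolution.ext hx hy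

theorem nsmul_polySolution (k : ℕ) (l : ℤ) : k • polySolution l = polySolution (k * l) := by
  rw [← map_nsmul, nsmul_eq_mul]

theorem polySolution_inBoundedOrder (ρ : ℝ) (n : ℤ) : (polySolution n).InBoundedOrder ρ :=
  ⟨polyEntire_mem_boundedOrder ρ _, polyEntire_mem_boundedOrder ρ _⟩

theorem pellY_neg (n : ℤ) : pellY (-n) = -pellY n := by
  apply polyEntire_injective
  calc
    polyEntire (pellY (-n)) = -polyEntire (pellY n) :=
      congrArg PellSolution.y (map_neg polySolution n)
    _ = polyEntire (-pellY n) := (map_neg polyEntireHom _).symm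

theorem pellY_dvd_pellY_mul (k l : ℤ) : pellY k ∣ pellY (k * l) := by
  induction l with
  | zero => simp [pellY, QuadraticAlgebra.im_one]
  | succ l ih =>
    rw [mul_add_one, pellY_add]
    exact dvd_add (dvd_mul_left _ _) (ih.mul_right _)
  | pred l ih =>
    rw [mul_sub_one, sub_eq_add_neg, pellY_add, pellY_neg]
    exact dvd_add ((dvd_neg.2 dvd_rfl).mul_left _) (ih.mul_right _)

theorem DvdBoundedOrder.dvd {ρ : ℝ} {f g : Entire} (h : DvdBoundedOrder ρ f g) : f ∣ g :=
  let ⟨_, _, q, _, hq⟩ := h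
  ⟨q, hq⟩

theorem dvdBoundedOrder_polyEntire (ρ : ℝ) {P Q : ℂ[X]} (h : P ∣ Q) :
    DvdBoundedOrder ρ (polyEntire P) (polyEntire Q) := by
  obtain ⟨R, rfl⟩ := h
  exact ⟨polyEntire_mem_boundedOrder ρ _, polyEntire_mem_boundedOrder ρ _, polyEntire R,
    polyEntire_mem_boundedOrder ρ _, map_mul polyEntireHom P R⟩

end PolynomialSolutions

section DivisibilityByPellY

open Complex

theorem hypEval_polySolution (n : ℤ) (u : ℂ) : (polySolution n).hypEval u = exp (n * u) := by
  have hone : (polySolution 1).hypEval u = exp u := by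
    simp [PellSolution.hypEval, polySolution, polyEntire, pellX, pellY, zAddW, cosh_add_sinh]
  have hsmul : polySolution n = n • polySolution 1 := by rw [← map_zsmul, zsmul_one, Int.cast_id]
  rw [hsmul, PellSolution.hypEval_zsmul, hone, exp_int_mul]

theorem eval_pellY_cosh_mul_sinh (n : ℤ) (u : ℂ) :
    (pellY n).eval (cosh u) * sinh u = sinh (n * u) := by
  have h := (polySolution n).y_cosh_mul_sinh u
  rwa [hypEval_polySolution, hypEval_polySolution, mul_neg] at h

namespace PellSolution

theorem hypEval_sq_eq_one_of_dvd {a : PellSolution} {k : ℤ} (h : polyEntire (pellY k) ∣ a.y)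
    {u : ℂ} (hu : sinh (k * u) = 0) : a.hypEval u ^ 2 = 1 := by
  obtain ⟨g, hg⟩ := h
  have hy : a.y.1 (cosh u) * sinh u = 0 := by
    have hmul : a.y.1 (cosh u) = (pellY k).eval (cosh u) * g.1 (cosh u) := by rw [hg]; rfl
    rw [hmul, mul_right_comm, eval_pellY_cosh_mul_sinh, hu, zero_mul]
  have heven : a.hypEval u = a.hypEval (-u) := by
    linear_combination 2 * hy - 2 * a.y_cosh_mul_sinh u
  have hmul := a.hypEval_mul_hypEval_neg u
  rwa [← heven, ← sq] at hmul

theorem sq_eq_one_of_hypEval_eq {a : PellSolution} {ε : ℂ} {n : ℤ}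
    (h : ∀ u, a.hypEval u = ε * exp (n * u)) : ε ^ 2 = 1 := by
  simpa [h, sq] using a.hypEval_mul_hypEval_neg 0

theorem y_eq_of_hypEval_eq {a : PellSolution} {ε : ℂ} {n : ℤ}
    (h : ∀ u, a.hypEval u = ε * exp (n * u)) :
    a.y = polyEntire (pellY n) ∨ a.y = polyEntire (pellY (-n)) := by
  have hy : a.y.1 = ε • (polyEntire (pellY n)).1 :=
    y_eq_smul_of_hypEval_eq_mul (b := polySolution n) fun u => by rw [h, hypEval_polySolution]
  have hε := sq_eq_one_of_hypEval_eq h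
  rw [sq, mul_self_eq_one_iff] at hε
  rcases hε with rfl | rfl
  · exact Or.inl (Subtype.ext (by rw [hy, one_smul]))
  · refine Or.inr (Subtype.ext ?_)
    rw [hy, neg_one_smul, pellY_neg]
    exact congrArg Subtype.val (map_neg polyEntireHom (pellY n)).symm

theorem exists_hypEval_eq_mul_exp {ρ : ℝ} (hρ : 0 ≤ ρ) {p k : ℕ} (hp : p.Prime)
    (hpρ : 2 * ⌊ρ⌋₊ + 1 < p) (hk : k ≠ 0) (hpk : p ∣ k) {b : PellSolution}
    (hb : b.InBoundedOrder ρ) (hdvd : polyEntire (pellY k) ∣ (k • b).y) :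
    ∃ (ε : ℂ) (n : ℤ), ∀ u, b.hypEval u = ε * exp (n * u) := by
  obtain ⟨n, c, hexp⟩ := hb.exists_hypEval_eq_exp_laurent hρ
  have hpow (u : ℂ) (hu : exp u ^ p = 1) : b.hypEval u ^ (k * 2) = 1 := by
    have hku : exp (k * u) = 1 := by
      obtain ⟨q, rfl⟩ := hpk
      rw [exp_nat_mul, pow_mul, hu, one_pow]
    have hsinh : sinh ((k : ℤ) * u) = 0 := by
      rw [Int.cast_natCast, sinh, exp_neg, hku, inv_one, sub_self, zero_div]
    rw [pow_mul, ← hypEval_nsmul]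
    exact hypEval_sq_eq_one_of_dvd hdvd hsinh
  simp_rw [hexp] at hpow
  have hcoeff (i : ℤ) (hi : i ∈ Finset.Icc (-(⌊ρ⌋₊ : ℤ)) ⌊ρ⌋₊) (hi0 : i ≠ 0) : c i = 0 :=
    coeff_eq_zero_of_exp_pow_eq_one hp hpρ (mul_ne_zero hk two_ne_zero) (hpk.mul_right 2) hpow hi
      hi0
  refine ⟨exp (c 0), n, fun u => ?_⟩
  rw [hexp, Finset.sum_eq_single_of_mem 0 (by simp) fun j hj hj0 => by
    rw [hcoeff j hj hj0, zero_mul], exp_add, mul_comm, Int.cast_zero, zero_mul, exp_zero, mul_one]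

theorem exists_nsmul_y_eq_pellY {ρ : ℝ} (hρ : 0 ≤ ρ) {p k : ℕ} (hp : p.Prime)
    (hpρ : 2 * ⌊ρ⌋₊ + 1 < p) (hpk : p ∣ k) {b : PellSolution} (hb : b.InBoundedOrder ρ)
    (hdvd : polyEntire (pellY k) ∣ (k • b).y) :
    ∃ n : ℤ, (k • b).y = polyEntire (pellY (k * n)) := by
  rcases eq_or_ne k 0 with rfl | hk
  · refine ⟨0, ?_⟩
    rw [zero_smul, mul_zero]
    exact congrArg PellSolution.y (map_zero polySolution).symm
  obtain ⟨ε, n, hexp⟩ := exists_hypEval_eq_mul_exp hρ hp hpρ hk hpk hb hdvd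
  have hkb (u : ℂ) : (k • b).hypEval u = ε ^ k * exp ((k * n : ℤ) * u) := by
    rw [hypEval_nsmul, hexp, mul_pow, ← exp_nat_mul]
    push_cast
    ring_nf
  rcases y_eq_of_hypEval_eq hkb with hy | hy
  · exact ⟨n, hy⟩
  · exact ⟨-n, by rw [hy, mul_neg]⟩

end PellSolution

end DivisibilityByPellY

theorem lemma5p1_general (ρ : ℝ) (hρ : 0 ≤ ρ) {p k : ℕ} (hp : p.Prime)
    (hpρ : 2 * ⌊ρ⌋₊ + 1 < p) (hpk : p ∣ k) :
    (∀ a : PellSolution, (∃ b : PellSolution, b.InBoundedOrder ρ ∧ k • b = a) →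
      polyEntire (pellY k) ∣ a.y → ∃ n : ℤ, a.y = polyEntire (pellY (k * n))) ∧
    (∀ l : ℤ, ∃ a : PellSolution,
      a.x = polyEntire (pellX (k * l)) ∧ a.y = polyEntire (pellY (k * l)) ∧
      a.InBoundedOrder ρ ∧
      (∃ b : PellSolution, b.InBoundedOrder ρ ∧ k • b = a) ∧
      DvdBoundedOrder ρ (polyEntire (pellY k)) a.y) := by
  constructor
  · rintro _ ⟨b, hb, rfl⟩ hdvd
    exact PellSolution.exists_nsmul_y_eq_pellY hρ hp hpρ hpk hb hdvd
  · exact fun l => ⟨polySolution (k * l), rfl, rfl, polySolution_inBoundedOrder ρ _,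
      ⟨polySolution l, polySolution_inBoundedOrder ρ l, nsmul_polySolution k l⟩,
      dvdBoundedOrder_polyEntire ρ (pellY_dvd_pellY_mul k l)⟩

theorem lemma5p1 (ρ : ℝ) (hρ : 0 ≤ ρ) (m p q k : ℕ) (hm : m = 2 * (⌊ρ⌋₊ + 1))
    (hp : p.Prime) (hq : q.Prime) (hpm : m + 1 < p) (hqm : 2 * (m + 1) < q)
    (hk : k = p * q) :
    (∀ a : PellSolution, a.InBoundedOrder ρ →
      (∃ b : PellSolution, b.InBoundedOrder ρ ∧ k • b = a) →
      DvdBoundedOrder ρ (polyEntire (pellY k)) a.y →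
      ∃ n : ℤ, a.y = polyEntire (pellY (k * n))) ∧
    (∀ l : ℤ, ∃ a : PellSolution,
      a.x = polyEntire (pellX (k * l)) ∧ a.y = polyEntire (pellY (k * l)) ∧
      a.InBoundedOrder ρ ∧
      (∃ b : PellSolution, b.InBoundedOrder ρ ∧ k • b = a) ∧
      DvdBoundedOrder ρ (polyEntire (pellY k)) a.y) := by
  have h := lemma5p1_general ρ hρ hp (by lia) (hk ▸ dvd_mul_right p q)
  exact ⟨fun a _ hb hdvd => h.1 a hb hdvd.dvd, h.2⟩
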